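/- Let $p$ be a prime, $m$ a positive integer, $q=p^m$, and let $k$ be a positive integer with $k<m$. Let $t\in\mathbb{F}_q$ satisfy $\mathrm{Tr}_{\mathbb{F}_q/\mathbb{F}_2}(t)=1$ if $q$ is even, and let $1-4t$ be a non-square in $\mathbb{F}_q$ if $q$ is odd. For a function $F=(G,H):\mathbb{F}_q^2\to\mathbb{F}_q^2$ and $a=(a_1,a_2)$, $b=(b_1,b_2)$, $c=(c_1,c_2)\in\mathbb{F}_q^2$ let ${}_c\Delta_F(a,b)$ be the number of $(x,y)\in\mathbb{F}_q^2$ with $$\begin{cases}G(x+a_1,y+a_2)-c_1G(x,y)+tc_2H(x,y)=b_1,\\ H(x+a_1,y+a_2)-(c_1-c_2)H(x,y)-c_2G(x,y)=b_2,\end{cases}$$ and let the $c$-differential uniformity ${}_c\Delta_F$ be the maximum of ${}_c\Delta_F(a,b)$ over all $a,b\in\mathbb{F}_q^2$, where $a\neq(0,0)$ is required if $c=(1,0)$. **Theorem.** Let $L(x)=\sum_i l_i x^{p^i}\in\mathbb{F}_q[x]$ be a linearized polynomial that permutes $\mathbb{F}_q$, let $\alpha\in\mathbb{F}_q$, and let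 $F(x,y)=(L(x),\,y^{p^k+1}+\alpha y+L(x))$. Let $c=(c_1,c_2)\in\mathbb{F}_q^2\setminus\{(1,0)\}$ and put $$\rho=\frac{1-c_1+tc_2}{tc_2^2+(1-c_1)c_2+(1-c_1)^2}$$ (the denominator is nonzero). 1. Suppose $m\neq 2k$. If $\alpha=0$ and $\rho\in\mathbb{F}_{p^{\gcd(m,k)}}$, then ${}_c\Delta_F=\gcd(p^k+1,p^m-1)$. Otherwise ${}_c\Delta_F=p^{\gcd(m,k)}+1$. 2. Suppose $m=2k$. If $\alpha\neq 0$ and $\rho\in\mathbb{F}_{p^k}$, then ${}_c\Delta_F=2$. Otherwise ${}_c\Delta_F=p^k+1$. -/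

import Mathlib

/-- A linearized polynomial over a field `K` of characteristic `p`: a polynomial of the form
`∑ i < n, a i * X ^ (p ^ i)` with coefficients in `K`. -/
def IsLinearizedPoly {K : Type*} [Field K] (p : ℕ) (f : Polynomial K) : Prop :=
  ∃ (n : ℕ) (a : ℕ → K),
    f = ∑ i ∈ Finset.range n, Polynomial.C (a i) * Polynomial.X ^ (p ^ i)

/-- A permutation polynomial over `K`: its evaluation map is a bijection of `K`. -/
def IsPermutationPoly {K : Type*} [Field K] (f : Polynomial K) : Prop :=
  Function.Bijective (fun x : K => f.eval x)

/-- `x` lies in the subfield of the finite field `K` that has `N` elements. (A finite field has at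
most one subfield of a given cardinality.) -/
def MemSubfieldOfCard {K : Type*} [Field K] (N : ℕ) (x : K) : Prop :=
  ∃ E : Subfield K, Nat.card E = N ∧ x ∈ E

/-- The standing assumption on `t` for a finite field `K` of characteristic `p`: the absolute trace
of `t` is `1` if `p = 2`, and `1 - 4 t` is a non-square if `p` is odd. -/
def IsAdmissibleParam (p : ℕ) {K : Type*} [Field K] [Algebra (ZMod p) K] (t : K) : Prop :=
  (p = 2 → Algebra.trace (ZMod p) K t = 1) ∧ (p ≠ 2 → ¬ IsSquare (1 - 4 * t))

/-- The left-hand side of the `c`-differential equation of `F = (G, H) : K² → K²` at `z = (x, y)` in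
direction `a`, for the multiplication
`(x₁, y₁) (x₂, y₂) = (x₁ x₂ - t y₁ y₂, x₁ y₂ + x₂ y₁ - y₁ y₂)` on `K²`. -/
def cDerivative {K : Type*} [Field K] (t : K) (F : K × K → K × K) (c a z : K × K) : K × K :=
  ((F (z + a)).1 - c.1 * (F z).1 + t * c.2 * (F z).2,
   (F (z + a)).2 - (c.1 - c.2) * (F z).2 - c.2 * (F z).1)

/-- The `c`-differential distribution table: the number of `z ∈ K²` solving the `c`-differential
equation with parameters `a` and `b`. -/
noncomputable def cDDT {K : Type*} [Field K] (t : K) (F : K × K → K × K) (c a b : K × K) : ℕ :=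
  Nat.card {z : K × K // cDerivative t F c a z = b}

open Classical in
/-- The `c`-differential uniformity of `F`: the maximum of the entries `cDDT t F c a b` over all
`a, b ∈ K²`, with `a ≠ (0, 0)` when `c = (1, 0)`. -/
noncomputable def cDifferentialUniformity {K : Type*} [Field K] [Fintype K] (t : K)
    (F : K × K → K × K) (c : K × K) : ℕ :=
  ((Finset.univ : Finset ((K × K) × (K × K))).filter
    (fun ab => c = (1, 0) → ab.1 ≠ (0, 0))).sup (fun ab => cDDT t F c ab.1 ab.2)

/-- The bivariate function `F(x, y) = (L(x), y ^ (p ^ k + 1) + α y + L(x))`. -/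
def goldBivariate {K : Type*} [Field K] (p k : ℕ) (α : K) (L : Polynomial K) :
    K × K → K × K :=
  fun z => (L.eval z.1, z.2 ^ (p ^ k + 1) + α * z.2 + L.eval z.1)

/-- The ratio `(1 - c₁ + t c₂) / (t c₂² + (1 - c₁) c₂ + (1 - c₁)²)`. -/
def cRatio {K : Type*} [Field K] (t : K) (c : K × K) : K :=
  (1 - c.1 + t * c.2) / (t * c.2 ^ 2 + (1 - c.1) * c.2 + (1 - c.1) ^ 2)

/-! Put Q = p^k, d = gcd(m, k), u = 1 - c₁, and let D be the denominator of ρ, nonzero because r² +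
r + t has no root in 𝔽_q. The two equations carry `L(x)` with coefficients u + t c₂ and u.
Eliminating it leaves an equation in y with leading coefficient D; dividing by D and shifting y by ρ
a₂ turns it into y^(Q+1) + w y = γ with w = (ρ - ρ^Q) a₂^Q + α, while `L(x)`, hence x, is recovered
from y. So the uniformity is the largest fibre of y^(Q+1) + w y over the available w: only w = α if
ρ^Q = ρ, and every w otherwise. For w = 0 the largest fibre has gcd(Q + 1, q - 1) elements. For w ≠
0 it has p^d + 1 if m ≠ 2k (`ncard_goldFiber_le`, `exists_ncard_goldFiber_eq`) and 2 if m = 2k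
(`ncard_goldFiber_le_two`). -/

section FixedField

variable {K : Type*} [Field K]

/-- The subfield of `K` fixed by the `k`-th power of the Frobenius map. -/
def frobeniusFixedField (K : Type*) [Field K] (p k : ℕ) [Fact p.Prime] [CharP K p] : Subfield K :=
  RingHom.eqLocusField (iterateFrobenius K p k) (RingHom.id K)

theorem mem_frobeniusFixedField {p k : ℕ} [Fact p.Prime] [CharP K p] {x : K} :
    x ∈ frobeniusFixedField K p k ↔ x ^ p ^ k = x := by
  change iterateFrobenius K p k x = x ↔ _
  rw [iterateFrobenius_def]

theorem ncard_pow_eq_one [Finite K] {n : ℕ} (hn : n ≠ 0) :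
    {x : K | x ^ n = 1}.ncard = Nat.gcd (Nat.card K - 1) n := by
  have h : {x : K | x ^ n = 1} = Units.val '' ((powMonoidHom n : Kˣ →* Kˣ).ker : Set Kˣ) := by
    ext x
    constructor
    · intro hx
      have hx' : x ^ n = 1 := hx
      refine ⟨Units.mk0 x ?_, ?_, rfl⟩
      · rintro rfl
        simp [hn] at hx'
      · simp [Units.ext_iff, hx']
    · rintro ⟨u, hu, rfl⟩
      have hu' : u ^ n = 1 := by simpa using hu
      simpa [Units.ext_iff] using hu'
  rw [h, Set.ncard_image_of_injective _ Units.val_injective, ← Nat.card_units,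
    ← IsCyclic.card_powMonoidHom_ker]
  rfl

theorem card_frobeniusFixedField {p m k : ℕ} [Fact p.Prime] [CharP K p] [Finite K]
    (hcard : Nat.card K = p ^ m) (hk : 0 < k) :
    Nat.card (frobeniusFixedField K p k) = p ^ Nat.gcd m k := by
  have hp : 1 < p := (Fact.out : p.Prime).one_lt
  have hQ : 1 < p ^ k := Nat.one_lt_pow hk.ne' hp
  have h : (frobeniusFixedField K p k : Set K) = insert 0 {x : K | x ^ (p ^ k - 1) = 1} := by
    ext x
    rw [SetLike.mem_coe, mem_frobeniusFixedField, Set.mem_insert_iff, Set.mem_ofPred_eq]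
    obtain ⟨n, hn⟩ : ∃ n, p ^ k = n + 1 := ⟨p ^ k - 1, by omega⟩
    rw [hn, Nat.add_sub_cancel, pow_succ, mul_left_eq_self₀, or_comm]
  have h0 : (0 : K) ∉ {x : K | x ^ (p ^ k - 1) = 1} := by
    have : p ^ k - 1 ≠ 0 := by omega
    simp [this]
  change Nat.card (frobeniusFixedField K p k : Set K) = _
  rw [Nat.card_coe_set_eq, h, Set.ncard_insert_of_notMem h0 (Set.toFinite _),
    ncard_pow_eq_one (by omega), hcard, Nat.pow_sub_one_gcd_pow_sub_one]
  exact Nat.sub_add_cancel (Nat.one_le_pow _ _ (by omega))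

theorem memSubfieldOfCard_iff {p m k : ℕ} [Fact p.Prime] [CharP K p] [Finite K]
    (hcard : Nat.card K = p ^ m) (hk : 0 < k) (x : K) :
    MemSubfieldOfCard (p ^ Nat.gcd m k) x ↔ x ^ p ^ k = x := by
  constructor
  · rintro ⟨E, hE, hx⟩
    have := Fintype.ofFinite E
    obtain ⟨j, hj⟩ := Nat.gcd_dvd_right m k
    have h := FiniteField.pow_card_pow j (⟨x, hx⟩ : E)
    rw [← Nat.card_eq_fintype_card, hE, ← pow_mul, ← hj] at h
    exact congrArg Subtype.val h
  · intro hx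
    exact ⟨frobeniusFixedField K p k, card_frobeniusFixedField hcard hk,
      mem_frobeniusFixedField.2 hx⟩

end FixedField

/-! ### Fibre sizes of y^(Q+1) + w y, with Q = p^k. -/

section GoldFiber

variable {K : Type*} [Field K]

/-- The fibre over `γ` of the map `y ↦ y ^ (p ^ k + 1) + w y`. -/
def goldFiber (p k : ℕ) (w γ : K) : Set K := {y | y ^ (p ^ k + 1) + w * y = γ}

theorem mem_goldFiber {p k : ℕ} {w γ y : K} :
    y ∈ goldFiber p k w γ ↔ y ^ p ^ k * y + w * y = γ := by
  rw [← pow_succ]; rfl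

/-- Subtracting the equations of two solutions and dividing by (y - y₀)^(Q+1) leaves an equation
affine over the fixed field in the inverse difference. -/
theorem inv_sub_of_mem_goldFiber {p k : ℕ} [Fact p.Prime] [CharP K p] {w γ y₀ y : K}
    (h₀ : y₀ ∈ goldFiber p k w γ) (h : y ∈ goldFiber p k w γ) (hne : y ≠ y₀) :
    (y₀ ^ p ^ k + w) * ((y - y₀)⁻¹) ^ p ^ k + y₀ * (y - y₀)⁻¹ + 1 = 0 := by
  rw [mem_goldFiber] at h₀ h
  have hs : y - y₀ ≠ 0 := sub_ne_zero.2 hne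
  obtain ⟨s, rfl⟩ : ∃ s, y = y₀ + s := ⟨y - y₀, by ring⟩
  rw [add_sub_cancel_left] at hs ⊢
  rw [add_pow_char_pow] at h
  have hsQ : s ^ p ^ k ≠ 0 := pow_ne_zero _ hs
  rw [inv_pow]
  field_simp
  linear_combination h - h₀

/-- The equation `y ^ (p ^ k + 1) + w y = γ` has at most `p ^ gcd(m, k) + 1` solutions: the cross
ratio of three fixed solutions and a fourth one lies in the fixed field of `x ↦ x ^ (p ^ k)`. -/
theorem ncard_goldFiber_le {p m k : ℕ} [Fact p.Prime] [CharP K p] [Finite K]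
    (hcard : Nat.card K = p ^ m) (hk : 0 < k) (w γ : K) :
    (goldFiber p k w γ).ncard ≤ p ^ Nat.gcd m k + 1 := by
  have hp : 1 < p := (Fact.out : p.Prime).one_lt
  have h1 : 1 ≤ p ^ Nat.gcd m k := Nat.one_le_pow _ _ (by omega)
  by_contra! hlt
  obtain ⟨y₀, h₀, y₁, h₁, y₂, h₂, h01, h02, h12⟩ := (Set.two_lt_ncard (Set.toFinite _)).1
    (show 2 < (goldFiber p k w γ).ncard by omega)
  set z : K → K := fun y => (y - y₀)⁻¹ with hz
  have hzinj : Function.Injective z := fun a b hab => by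
    simpa [hz] using hab
  have key : ∀ y ∈ goldFiber p k w γ, y ≠ y₀ →
      (y₀ ^ p ^ k + w) * z y ^ p ^ k + y₀ * z y + 1 = 0 :=
    fun y h hne => inv_sub_of_mem_goldFiber h₀ h hne
  have e₁ := key y₁ h₁ h01.symm
  have e₂ := key y₂ h₂ h02.symm
  have hA : y₀ ^ p ^ k + w ≠ 0 := by
    intro hA
    rw [hA] at e₁ e₂
    have hy₀ : y₀ ≠ 0 := by
      rintro rfl
      simp at e₁
    apply h12
    apply hzinj
    apply mul_left_cancel₀ hy₀
    linear_combination e₁ - e₂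
  have hd : z y₂ - z y₁ ≠ 0 := sub_ne_zero.2 fun h => h12 (hzinj h).symm
  -- Differences of inverses satisfy the homogeneous equation A Z^Q + y₀ Z = 0 with A ≠ 0, so ratios
  -- of them are fixed by Z ↦ Z^Q.
  have hmaps : ∀ y ∈ goldFiber p k w γ \ {y₀},
      (z y - z y₁) / (z y₂ - z y₁) ∈ (frobeniusFixedField K p k : Set K) := by
    rintro y ⟨hy, hne⟩
    have e := key y hy hne
    rw [SetLike.mem_coe, mem_frobeniusFixedField, div_pow, div_eq_div_iff (pow_ne_zero _ hd) hd,
      sub_pow_char_pow, sub_pow_char_pow]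
    apply mul_left_cancel₀ hA
    linear_combination (z y₂ - z y₁) * (e - e₁) - (z y - z y₁) * (e₂ - e₁)
  have hle := Set.ncard_le_ncard_of_injOn _ hmaps (fun a _ b _ hab => by
    apply hzinj
    simpa [div_left_inj' hd] using hab) (Set.toFinite _)
  rw [Set.ncard_sdiff_singleton_of_mem h₀] at hle
  have : (frobeniusFixedField K p k : Set K).ncard = _ := card_frobeniusFixedField hcard hk
  omega

theorem exists_pow_ne_self {p m n : ℕ} [Finite K] (hp : 1 < p) (hcard : Nat.card K = p ^ m)
    [Fact p.Prime] [CharP K p] (hn : 0 < n) (h : ¬ m ∣ n) : ∃ x : K, x ^ p ^ n ≠ x := by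
  by_contra! hx
  have htop : frobeniusFixedField K p n = ⊤ := by
    ext x
    simp [mem_frobeniusFixedField, hx]
  have hc := card_frobeniusFixedField (K := K) hcard hn
  rw [htop, Nat.card_congr Subfield.topEquiv.toEquiv, hcard] at hc
  exact h (Nat.gcd_eq_left_iff_dvd.1 (Nat.pow_right_injective hp hc).symm)

/-- If `w ≠ 0` and `m ∤ 2 k`, then some fibre of `y ↦ y ^ (p ^ k + 1) + w y` has `p ^ gcd(m, k) + 1`
elements. -/
theorem exists_ncard_goldFiber_eq {p m k : ℕ} [Fact p.Prime] [CharP K p] [Finite K]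
    (hcard : Nat.card K = p ^ m) (hk : 0 < k) (hm : ¬ m ∣ 2 * k) {w : K} (hw : w ≠ 0) :
    ∃ γ, (goldFiber p k w γ).ncard = p ^ Nat.gcd m k + 1 := by
  have hp : 1 < p := (Fact.out : p.Prime).one_lt
  -- Moving x under the Q²-power map makes A below nonzero; this is where m ∤ 2k enters.
  obtain ⟨x, hx⟩ := exists_pow_ne_self (K := K) hp hcard (by omega) hm
  have hxx : (x ^ p ^ k) ^ p ^ k = x ^ p ^ (2 * k) := by rw [← pow_mul, ← pow_add, two_mul]
  rw [← hxx] at hx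
  set X := x ^ p ^ k with hX
  set X' := X ^ p ^ k with hX'
  have hxX : X - x ≠ 0 := by
    intro h
    have h' : X = x := sub_eq_zero.1 h
    apply hx
    rw [hX', h', ← hX, h']
  have hXX' : X' - x ≠ 0 := sub_ne_zero.2 hx
  -- the roots of `y ^ (Q + 1) + A y + B` are `1` and `(x + e) ^ (Q - 1)` with `e ^ Q = e`
  set A := -(X' - x) / (X - x) with hA
  set B := (X' - X) / (X - x) with hB
  have hA0 : A ≠ 0 := div_ne_zero (neg_ne_zero.2 hXX') hxX
  -- A and B are chosen so that Z^(Q²) + A Z^Q + B Z kills 1 and x, hence every x + e; dividing by x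
  -- + e gives the equation for (x + e)^(Q-1).
  have hAB : 1 + A + B = 0 := by rw [hA, hB]; field_simp; ring
  have hABx : X' + A * X + B * x = 0 := by rw [hA, hB]; field_simp; ring
  -- Scaling y by l changes the linear coefficient A into l^Q A = w.
  obtain ⟨l, hl⟩ : ∃ l : K, l ^ p ^ k = w / A := by
    obtain ⟨l, hl⟩ := (Finite.injective_iff_surjective.1 (iterateFrobenius K p k).injective) (w / A)
    exact ⟨l, by rw [← hl, iterateFrobenius_def]⟩
  have hQ : p ^ k ≠ 0 := by positivity
  have hl0 : l ≠ 0 := by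
    rintro rfl
    rw [zero_pow hQ] at hl
    exact div_ne_zero hw hA0 hl.symm
  have hwl : w = l ^ p ^ k * A := by rw [hl]; field_simp
  refine ⟨-(l ^ p ^ k * l * B), le_antisymm (ncard_goldFiber_le hcard hk _ _) ?_⟩
  have hmem : ∀ y : K, y ^ p ^ k * y + A * y + B = 0 →
      l * y ∈ goldFiber p k w (-(l ^ p ^ k * l * B)) := fun y hy => by
    rw [mem_goldFiber, mul_pow, hwl]
    linear_combination l ^ p ^ k * l * hy
  set E : Set K := (frobeniusFixedField K p k : Set K) with hE
  have hEmem : ∀ e ∈ E, e ^ p ^ k = e := fun e he => mem_frobeniusFixedField.1 he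
  have hxe : ∀ e ∈ E, x + e ≠ 0 := by
    intro e he h
    have h1 : x = -e := eq_neg_of_add_eq_zero_left h
    apply hxX
    have : (-e) ∈ frobeniusFixedField K p k := neg_mem he
    rw [hX, h1, mem_frobeniusFixedField.1 this, sub_self]
  have hsub : insert (l * 1) ((fun e => l * ((X + e) / (x + e))) '' E) ⊆
      goldFiber p k w (-(l ^ p ^ k * l * B)) := by
    rintro y (rfl | ⟨e, he, rfl⟩)
    · exact hmem 1 (by rw [one_pow]; linear_combination hAB)
    · have hxe0 := hxe e he
      have hXe : (x + e) ^ p ^ k = X + e := by rw [add_pow_char_pow, hEmem e he]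
      have hXe' : (X + e) ^ p ^ k = X' + e := by rw [add_pow_char_pow, hEmem e he]
      have hXe0 : X + e ≠ 0 := by rw [← hXe]; exact pow_ne_zero _ hxe0
      refine hmem _ ?_
      rw [div_pow, hXe, hXe']
      field_simp
      linear_combination hABx + e * hAB
  have hinj : Set.InjOn (fun e => l * ((X + e) / (x + e))) E := by
    intro e he e' he' hee
    have h := mul_left_cancel₀ hl0 hee
    rw [div_eq_div_iff (hxe e he) (hxe e' he')] at h
    apply mul_left_cancel₀ hxX
    linear_combination -h
  have hnot : l * 1 ∉ (fun e => l * ((X + e) / (x + e))) '' E := by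
    rintro ⟨e, he, h⟩
    have h' := mul_left_cancel₀ hl0 h
    rw [div_eq_one_iff_eq (hxe e he)] at h'
    exact hxX (by linear_combination h')
  have hcardE : E.ncard = p ^ Nat.gcd m k := card_frobeniusFixedField hcard hk
  rw [← hcardE, ← hinj.ncard_image, ← Set.ncard_insert_of_notMem hnot]
  exact Set.ncard_le_ncard hsub

theorem ncard_goldFiber_zero_one {p k : ℕ} [Finite K] :
    (goldFiber p k (0 : K) 1).ncard = Nat.gcd (p ^ k + 1) (Nat.card K - 1) := by
  rw [Nat.gcd_comm, ← ncard_pow_eq_one (Nat.succ_ne_zero _)]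
  simp [goldFiber]

/-- Dividing by one nonzero solution embeds the fibre in the (Q+1)-th roots of unity. -/
theorem ncard_goldFiber_zero_le {p k : ℕ} [Finite K] (γ : K) :
    (goldFiber p k 0 γ).ncard ≤ Nat.gcd (p ^ k + 1) (Nat.card K - 1) := by
  rw [← ncard_goldFiber_zero_one]
  rcases (goldFiber p k 0 γ).eq_empty_or_nonempty with h | ⟨y₀, h₀⟩
  · simp [h]
  rcases eq_or_ne y₀ 0 with rfl | hy₀
  · have hγ : γ = 0 := by simpa [goldFiber] using h₀.symm
    have h1 : (goldFiber p k (0 : K) γ).ncard ≤ ({0} : Set K).ncard := by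
      refine Set.ncard_le_ncard fun y hy => ?_
      simpa [goldFiber, hγ] using hy
    have h2 : ({1} : Set K).ncard ≤ (goldFiber p k (0 : K) 1).ncard :=
      Set.ncard_le_ncard (by simp [goldFiber])
    rw [Set.ncard_singleton] at h1 h2
    omega
  · refine Set.ncard_le_ncard_of_injOn (fun y => y / y₀) (fun y hy => ?_)
      (fun a _ b _ hab => (div_left_inj' hy₀).1 hab)
    simp only [goldFiber, Set.mem_ofPred_eq, zero_mul, add_zero] at hy h₀ ⊢
    rw [div_pow, hy, h₀, div_self]
    rw [← h₀]
    exact pow_ne_zero _ hy₀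

/-- If `|K| = p ^ (2 k)` and `w ≠ 0`, then `y ^ (p ^ k + 1)` takes at most two values on a fibre
of `y ↦ y ^ (p ^ k + 1) + w y`, being a root of a quadratic polynomial. -/
theorem ncard_goldFiber_le_two {p k : ℕ} [Fact p.Prime] [CharP K p] [Finite K]
    (hcard : Nat.card K = p ^ (2 * k)) {w : K} (hw : w ≠ 0) (γ : K) :
    (goldFiber p k w γ).ncard ≤ 2 := by
  have hfrob : ∀ x : K, (x ^ p ^ k) ^ p ^ k = x := fun x => by
    have := Fintype.ofFinite K
    rw [← pow_mul, ← pow_add, ← two_mul, ← hcard, Nat.card_eq_fintype_card, FiniteField.pow_card]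
  -- N = y^(Q+1) is fixed by the Q-th power since y^(Q²) = y. Multiply w y = γ - N by its Q-th
  -- power.
  have hquad : ∀ y ∈ goldFiber p k w γ, y ^ p ^ k * y * (w ^ p ^ k * w) =
      (γ ^ p ^ k - y ^ p ^ k * y) * (γ - y ^ p ^ k * y) := fun y hy => by
    rw [mem_goldFiber] at hy
    rw [← hy, add_pow_char_pow, mul_pow, mul_pow, hfrob]
    ring
  by_contra! hlt
  obtain ⟨a, ha, b, hb, c, hc, hab, hac, hbc⟩ := (Set.two_lt_ncard (Set.toFinite _)).1 hlt
  have hinj : ∀ y ∈ goldFiber p k w γ, ∀ y' ∈ goldFiber p k w γ, y ≠ y' →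
      y ^ p ^ k * y - y' ^ p ^ k * y' ≠ 0 := fun y hy y' hy' hne h => by
    rw [mem_goldFiber] at hy hy'
    apply hne
    apply mul_left_cancel₀ hw
    linear_combination hy - hy' - h
  have qa := hquad a ha
  have qb := hquad b hb
  have qc := hquad c hc
  have nab := hinj a ha b hb hab
  have nac := hinj a ha c hc hac
  have nbc := hinj b hb c hc hbc
  generalize a ^ p ^ k * a = a' at *
  generalize b ^ p ^ k * b = b' at *
  generalize c ^ p ^ k * c = c' at *
  have h1 : a' + b' = γ + γ ^ p ^ k + w ^ p ^ k * w :=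
    mul_left_cancel₀ nab (by linear_combination qb - qa)
  have h2 : a' + c' = γ + γ ^ p ^ k + w ^ p ^ k * w :=
    mul_left_cancel₀ nac (by linear_combination qc - qa)
  exact nbc (by linear_combination h1 - h2)

theorem two_le_ncard_goldFiber_zero {p k : ℕ} [Fact p.Prime] [CharP K p] [Finite K] {w : K}
    (hw : w ≠ 0) : 2 ≤ (goldFiber p k w 0).ncard := by
  obtain ⟨y, hy⟩ := (Finite.injective_iff_surjective.1 (iterateFrobenius K p k).injective) (-w)
  rw [iterateFrobenius_def] at hy
  have hQ : p ^ k ≠ 0 := pow_ne_zero _ (Fact.out : p.Prime).ne_zero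
  have hy0 : (0 : K) ≠ y := by
    rintro rfl
    rw [zero_pow hQ] at hy
    exact hw (neg_eq_zero.1 hy.symm)
  rw [← Set.ncard_pair hy0]
  refine Set.ncard_le_ncard ?_
  rintro z (rfl | rfl)
  · rw [mem_goldFiber]; simp
  · rw [mem_goldFiber, hy]; ring

end GoldFiber

/-! ### From the system in (x, y) to one equation in y. -/

section Reduction

variable {K : Type*} [Field K]

theorem IsLinearizedPoly.eval_add {p : ℕ} [Fact p.Prime] [CharP K p] {L : Polynomial K}
    (hL : IsLinearizedPoly p L) (x y : K) : L.eval (x + y) = L.eval x + L.eval y := by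
  obtain ⟨n, a, rfl⟩ := hL
  simp [Polynomial.eval_finsetSum, add_pow_char_pow, mul_add, Finset.sum_add_distrib]

/-- A root r would give t = r² + r of trace 0 in characteristic 2, and 1 - 4t = (2r + 1)² otherwise.
-/
theorem IsAdmissibleParam.sq_add_self_add_ne_zero {p : ℕ} [Fact p.Prime] [Finite K]
    [Algebra (ZMod p) K] {t : K} (ht : IsAdmissibleParam p t) (r : K) : r ^ 2 + r + t ≠ 0 := by
  intro h
  by_cases hp : p = 2
  · subst hp
    have : CharP K 2 := charP_of_injective_algebraMap (algebraMap (ZMod 2) K).injective 2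
    have htr := ht.1 rfl
    have : Fintype K := Fintype.ofFinite K
    have hsq : Algebra.trace (ZMod 2) K (r ^ 2) = Algebra.trace (ZMod 2) K r := by
      rw [← Algebra.trace_eq_of_algEquiv (FiniteField.frobeniusAlgEquivOfAlgebraic (ZMod 2) K) r]
      simp
    have h' : t = r ^ 2 + r := by
      linear_combination h - (r ^ 2 + r) * CharTwo.two_eq_zero (R := K)
    rw [h', map_add, hsq, CharTwo.add_self_eq_zero] at htr
    exact zero_ne_one htr
  · exact ht.2 hp ⟨2 * r + 1, by linear_combination -4 * h⟩

theorem IsAdmissibleParam.quadratic_ne_zero {p : ℕ} [Fact p.Prime] [Finite K]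
    [Algebra (ZMod p) K] {t : K} (ht : IsAdmissibleParam p t) {c : K × K} (hc : c ≠ (1, 0)) :
    t * c.2 ^ 2 + (1 - c.1) * c.2 + (1 - c.1) ^ 2 ≠ 0 := by
  intro h
  by_cases hv : c.2 = 0
  · have hu : 1 - c.1 = 0 := by simpa [hv] using h
    exact hc (Prod.ext (sub_eq_zero.1 hu).symm hv)
  · apply ht.sq_add_self_add_ne_zero ((1 - c.1) / c.2)
    field_simp
    linear_combination h

/-- The right-hand side of the univariate equation equivalent to the `c`-differential equation of
the bivariate Gold function. -/
noncomputable def goldTarget (p k : ℕ) (t : K) (L : Polynomial K) (c a b : K × K) : K :=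
  ((1 - c.1 + t * c.2) * (b.2 - L.eval a.1) - (1 - c.1) * (b.1 - L.eval a.1)) /
      (t * c.2 ^ 2 + (1 - c.1) * c.2 + (1 - c.1) ^ 2) -
    cRatio t c * (1 - cRatio t c) * (a.2 ^ p ^ k * a.2)

theorem cDDT_goldBivariate {p k : ℕ} [Fact p.Prime] [CharP K p] {t α : K} {L : Polynomial K}
    (hL : IsLinearizedPoly p L) (hLperm : IsPermutationPoly L) {c : K × K}
    (hD : t * c.2 ^ 2 + (1 - c.1) * c.2 + (1 - c.1) ^ 2 ≠ 0) (a b : K × K) :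
    cDDT t (goldBivariate p k α L) c a b =
      (goldFiber p k ((cRatio t c - cRatio t c ^ p ^ k) * a.2 ^ p ^ k + α)
        (goldTarget p k t L c a b)).ncard := by
  change Nat.card ({z : K × K | cDerivative t (goldBivariate p k α L) c a z = b} : Set (K × K)) = _
  rw [Nat.card_coe_set_eq]
  obtain ⟨c₁, c₂⟩ := c
  obtain ⟨a₁, a₂⟩ := a
  obtain ⟨b₁, b₂⟩ := b
  obtain ⟨u, rfl⟩ : ∃ u, c₁ = 1 - u := ⟨1 - c₁, by ring⟩
  simp only [sub_sub_cancel] at hD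
  set ρ := cRatio t (1 - u, c₂) with hρ
  set D := t * c₂ ^ 2 + u * c₂ + u ^ 2 with hDdef
  have hρD : ρ * D = u + t * c₂ := by
    rw [hρ, cRatio]
    simp only [sub_sub_cancel]
    exact div_mul_cancel₀ _ hD
  set γ := goldTarget p k t L (1 - u, c₂) (a₁, a₂) (b₁, b₂) with hγdef
  have hγ : (γ + ρ * (1 - ρ) * (a₂ ^ p ^ k * a₂)) * D =
      (u + t * c₂) * (b₂ - L.eval a₁) - u * (b₁ - L.eval a₁) := by
    rw [hγdef, goldTarget, sub_add_cancel]
    simp only [sub_sub_cancel]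
    exact div_mul_cancel₀ _ hD
  -- the system is equivalent to an equation in `y` and a formula for `L x`
  have hiff : ∀ x y : K, cDerivative t (goldBivariate p k α L) (1 - u, c₂) (a₁, a₂) (x, y) =
      (b₁, b₂) ↔
      y + ρ * a₂ ∈ goldFiber p k ((ρ - ρ ^ p ^ k) * a₂ ^ p ^ k + α) γ ∧
      D * L.eval x = c₂ * (b₁ - L.eval a₁ - t * c₂ * (y ^ p ^ k * y + α * y)) +
        u * (b₂ - L.eval a₁ - (((y ^ p ^ k + a₂ ^ p ^ k) * (y + a₂) + α * (y + a₂)) -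
          (1 - u - c₂) * (y ^ p ^ k * y + α * y))) := by
    intro x y
    rw [mem_goldFiber]
    simp only [cDerivative, goldBivariate, Prod.mk_add_mk, hL.eval_add, Prod.mk.injEq, pow_succ,
      add_pow_char_pow, mul_pow]
    generalize L.eval x = X at *
    generalize L.eval a₁ = A at *
    generalize y ^ p ^ k = Y at *
    generalize a₂ ^ p ^ k = a' at *
    generalize ρ ^ p ^ k = ρ' at *
    constructor
    · rintro ⟨h1, h2⟩
      constructor
      · apply mul_left_cancel₀ hD
        linear_combination (u + t * c₂) * h2 - u * h1 - hγ + (a' * y + a₂ * Y + α * a₂ + a' * a₂) * hρD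
      · linear_combination c₂ * h1 + u * h2
    -- The two combinations of the original equations form a matrix of determinant D, so they can be
    -- inverted.
    · rintro ⟨h3, h4⟩
      have h5 : (u + t * c₂) * ((Y + a') * (y + a₂) + α * (y + a₂) + (X + A) -
          (1 - u - c₂) * (Y * y + α * y + X) - c₂ * X - b₂) -
          u * (X + A - (1 - u) * X + t * c₂ * (Y * y + α * y + X) - b₁) = 0 := by
        linear_combination D * h3 + hγ - (a' * y + a₂ * Y + α * a₂ + a' * a₂) * hρD
      constructor
      · apply mul_left_cancel₀ hD
        linear_combination (u + t * c₂) * h4 - u * h5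
      · apply mul_left_cancel₀ hD
        linear_combination u * h4 + c₂ * h5
  rw [← Set.InjOn.ncard_image (f := fun z : K × K => z.2 + ρ * a₂)]
  · congr 1
    ext Y
    constructor
    · rintro ⟨⟨x, y⟩, hz, rfl⟩
      exact ((hiff x y).1 hz).1
    · intro hY
      have hy : Y = (Y - ρ * a₂) + ρ * a₂ := by ring
      generalize Y - ρ * a₂ = y at hy
      subst hy
      obtain ⟨x, hx⟩ := hLperm.2
        ((c₂ * (b₁ - L.eval a₁ - t * c₂ * (y ^ p ^ k * y + α * y)) +
        u * (b₂ - L.eval a₁ - (((y ^ p ^ k + a₂ ^ p ^ k) * (y + a₂) + α * (y + a₂)) -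
          (1 - u - c₂) * (y ^ p ^ k * y + α * y)))) / D)
      refine ⟨(x, y), (hiff x y).2 ⟨hY, ?_⟩, rfl⟩
      rw [show L.eval x = _ from hx, mul_div_cancel₀ _ hD]
  · rintro ⟨x, y⟩ hz ⟨x', y'⟩ hz' h
    obtain rfl : y = y' := add_right_cancel h
    have e := ((hiff x y).1 hz).2
    rw [← ((hiff x' y).1 hz').2] at e
    have hx : x = x' := hLperm.1 (mul_left_cancel₀ hD e)
    rw [hx]

theorem exists_goldTarget_eq {p k : ℕ} [Fact p.Prime] [CharP K p] {t : K} {L : Polynomial K}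
    {c : K × K} (hD : t * c.2 ^ 2 + (1 - c.1) * c.2 + (1 - c.1) ^ 2 ≠ 0) (a : K × K) (γ : K) :
    ∃ b, goldTarget p k t L c a b = γ := by
  set s := γ + cRatio t c * (1 - cRatio t c) * (a.2 ^ p ^ k * a.2) with hs
  -- With this b the numerator in `goldTarget` becomes s times the denominator.
  refine ⟨(L.eval a.1 - (1 - c.1) * s, L.eval a.1 + c.2 * s), ?_⟩
  rw [goldTarget, sub_eq_iff_eq_add, ← hs, div_eq_iff hD]
  ring

/-- The `c`-differential uniformity of the bivariate Gold function is the largest size of a fibre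
of a map `y ↦ y ^ (p ^ k + 1) + w y`, where `w` runs over `(ρ - ρ ^ (p ^ k)) a ^ (p ^ k) + α`. -/
theorem cDifferentialUniformity_goldBivariate {p k : ℕ} [Fact p.Prime] [CharP K p] [Fintype K]
    {t α : K} {L : Polynomial K} (hL : IsLinearizedPoly p L) (hLperm : IsPermutationPoly L)
    {c : K × K} (hc : c ≠ (1, 0)) (hD : t * c.2 ^ 2 + (1 - c.1) * c.2 + (1 - c.1) ^ 2 ≠ 0) {n : ℕ}
    (hle : ∀ a γ : K,
      (goldFiber p k ((cRatio t c - cRatio t c ^ p ^ k) * a ^ p ^ k + α) γ).ncard ≤ n)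
    (hge : ∃ a γ : K,
      n ≤ (goldFiber p k ((cRatio t c - cRatio t c ^ p ^ k) * a ^ p ^ k + α) γ).ncard) :
    cDifferentialUniformity t (goldBivariate p k α L) c = n := by
  refine le_antisymm (Finset.sup_le ?_) ?_
  · rintro ⟨a, b⟩ -
    rw [cDDT_goldBivariate hL hLperm hD]
    exact hle _ _
  · obtain ⟨a, γ, h⟩ := hge
    obtain ⟨b, rfl⟩ := exists_goldTarget_eq (p := p) (k := k) (L := L) hD (0, a) γ
    rw [← cDDT_goldBivariate hL hLperm hD (0, a) b] at h
    refine h.trans (Finset.le_sup (f := fun ab : (K × K) × (K × K) =>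
      cDDT t (goldBivariate p k α L) c ab.1 ab.2) (b := ((0, a), b)) ?_)
    simp [hc]

theorem exists_mul_pow_add_eq {p k : ℕ} [Fact p.Prime] [CharP K p] [Finite K] {s : K}
    (hs : s ≠ 0) (α w : K) : ∃ a : K, s * a ^ p ^ k + α = w := by
  obtain ⟨a, ha⟩ :=
    (Finite.injective_iff_surjective.1 (iterateFrobenius K p k).injective) ((w - α) / s)
  rw [iterateFrobenius_def] at ha
  exact ⟨a, by rw [ha]; field_simp; ring⟩

end Reduction

theorem mainTheorem2 (p m k : ℕ) [Fact p.Prime] {K : Type*} [Field K] [Fintype K]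
    [Algebra (ZMod p) K] (hcard : Fintype.card K = p ^ m)
    (hk : 0 < k) (hkm : k < m)
    (t : K) (ht : IsAdmissibleParam p t)
    (L : Polynomial K) (hL : IsLinearizedPoly p L) (hLperm : IsPermutationPoly L)
    (α : K) (c : K × K) (hc : c ≠ (1, 0)) :
    (m ≠ 2 * k →
      ((α = 0 ∧ MemSubfieldOfCard (p ^ Nat.gcd m k) (cRatio t c)) →
        cDifferentialUniformity t (goldBivariate p k α L) c
          = Nat.gcd (p ^ k + 1) (p ^ m - 1)) ∧
      (¬ (α = 0 ∧ MemSubfieldOfCard (p ^ Nat.gcd m k) (cRatio t c)) →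
        cDifferentialUniformity t (goldBivariate p k α L) c = p ^ Nat.gcd m k + 1)) ∧
    (m = 2 * k →
      ((α ≠ 0 ∧ MemSubfieldOfCard (p ^ k) (cRatio t c)) →
        cDifferentialUniformity t (goldBivariate p k α L) c = 2) ∧
      (¬ (α ≠ 0 ∧ MemSubfieldOfCard (p ^ k) (cRatio t c)) →
        cDifferentialUniformity t (goldBivariate p k α L) c = p ^ k + 1)) := by
  have : CharP K p := charP_of_injective_algebraMap (algebraMap (ZMod p) K).injective p
  have hq : Nat.card K = p ^ m := by rw [Nat.card_eq_fintype_card, hcard]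
  have hD := ht.quadratic_ne_zero hc
  have huni := fun n => cDifferentialUniformity_goldBivariate (p := p) (k := k) (t := t) (α := α)
    (n := n) hL hLperm hc hD
  have hmem := memSubfieldOfCard_iff (K := K) hq hk (cRatio t c)
  set ρ := cRatio t c
  -- outside the exceptional cases every `w`, or the given `α`, is available as a coefficient
  have hzero : MemSubfieldOfCard (p ^ Nat.gcd m k) ρ → ρ - ρ ^ p ^ k = 0 := fun h => by
    rw [hmem.1 h, sub_self]
  have hne : ¬ MemSubfieldOfCard (p ^ Nat.gcd m k) ρ → ∀ w, ∃ a : K,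
      (ρ - ρ ^ p ^ k) * a ^ p ^ k + α = w := fun h =>
    exists_mul_pow_add_eq (fun h' => h (hmem.2 (sub_eq_zero.1 h').symm)) α
  constructor
  · intro hm
    -- Since 0 < 2k < 2m, the only multiple of m that 2k could be is m itself.
    have hmk : ¬ m ∣ 2 * k := by
      rintro ⟨j, hj⟩
      have : j < 2 := by
        by_contra! h
        have := Nat.mul_le_mul_left m h
        omega
      interval_cases j <;> omega
    constructor
    · rintro ⟨rfl, hρ⟩
      simp only [hzero hρ, zero_mul, add_zero] at huni
      rw [← hq]
      exact huni _ (fun _ => ncard_goldFiber_zero_le) ⟨0, 1, ncard_goldFiber_zero_one.ge⟩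
    · intro hnot
      refine huni _ (fun _ _ => ncard_goldFiber_le hq hk _ _) ?_
      obtain ⟨a, ha⟩ : ∃ a : K, (ρ - ρ ^ p ^ k) * a ^ p ^ k + α ≠ 0 := by
        by_cases hρ : MemSubfieldOfCard (p ^ Nat.gcd m k) ρ
        · exact ⟨0, by simpa [hzero hρ] using fun h => hnot ⟨h, hρ⟩⟩
        · obtain ⟨a, ha⟩ := hne hρ 1
          exact ⟨a, by rw [ha]; exact one_ne_zero⟩
      obtain ⟨γ, hγ⟩ := exists_ncard_goldFiber_eq hq hk hmk ha
      exact ⟨a, γ, hγ.ge⟩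
  · rintro rfl
    have hgcd : Nat.gcd (2 * k) k = k := Nat.gcd_eq_right (Dvd.intro_left 2 rfl)
    have hle := fun w γ : K => ncard_goldFiber_le hq hk w γ
    rw [hgcd] at hzero hne
    simp only [hgcd] at hle
    constructor
    · rintro ⟨hα, hρ⟩
      simp only [hzero hρ, zero_mul, zero_add] at huni
      exact huni _ (fun _ => ncard_goldFiber_le_two hq hα)
        ⟨0, 0, two_le_ncard_goldFiber_zero hα⟩
    · intro hnot
      refine huni _ (fun _ _ => hle _ _) ?_
      -- For m = 2k the coefficient w = 0 is the extremal one: Q + 1 divides q - 1 = Q² - 1.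
      obtain ⟨a, ha⟩ : ∃ a : K, (ρ - ρ ^ p ^ k) * a ^ p ^ k + α = 0 := by
        by_cases hρ : MemSubfieldOfCard (p ^ k) ρ
        · exact ⟨0, by simpa [hzero hρ] using fun h => hnot ⟨h, hρ⟩⟩
        · exact hne hρ 0
      refine ⟨a, 1, ?_⟩
      rw [ha, ncard_goldFiber_zero_one, hq, Nat.gcd_eq_left]
      refine ⟨p ^ k - 1, ?_⟩
      rw [mul_comm 2 k, pow_mul, ← Nat.sq_sub_sq, one_pow]
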